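/- **Setting.** Let $\mathcal H_s,\mathcal H_e$ be complex Hilbert spaces, let $\mathcal H_s\otimes\mathcal H_e$ be their Hilbert space tensor product, let $t_0<t_1$ be real and let $r\ge 1$. Consider the Schrödinger equation $$\frac{d\xi}{dt}=\Big[H_0(t)\otimes 1+1\otimes H_e(t)+H_{SB}(t)+\sum_{i=1}^r u_i(t)\,H_i(t)\otimes 1\Big]\xi ,\qquad t\in[t_0,t_1],$$ with time-dependent, possibly unbounded, skew-Hermitian operators, and the output $y=\langle\xi|C(t)|\xi\rangle$, where $C(t)$ acts on $\mathcal H_s$ (as $C(t)\otimes 1$) and need not be Hermitian. All operators, and the adjoint of $C(t)$, are defined on a common invariant domain $\mathcal D\subset\mathcal H_s\otimes\mathcal H_e$ which contains all $\varphi\otimes\chi$ with $\varphi\in\mathcal D_s$, $\chi\in\mathcal D_e$; here $\mathcal D_s\subset\mathcal H_s$ and $\mathcal D_e\subset\mathcal H_e$ are dense domains, invariant under the operators acting on $\mathcal H_s$ (including the adjoint of $C(t)$) and on $\mathcal H_e$ respectively. Let $\mathcal U$ be a class of admissible real controls $u=(u_1,\dots,u_r)$: each is piecewise analytic on $[t_0,t_1]$,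 and all piecewise constant ones with values in $U$ belong to $\mathcal U$, for some set $U\subset\mathbb R^r$ that is not contained in a proper affine subspace. A solution is a norm-continuous curve in $\mathcal D$ that satisfies the equation with the right derivative. The system is assumed to evolve on $\mathcal D$ and to be analytic: * for every $u\in\mathcal U$, $s\in[t_0,t_1]$ and $\xi_0\in\mathcal D$ there is a solution on $[s,t_1]$ with $\xi(s)=\xi_0$, both for the given $H_{SB}$ and with $H_{SB}$ replaced by $0$; * let $\mathcal W$ be the set of operator families obtained from $1,H_0,H_i,H_e,H_{SB},C,C^\dagger$ by composition and time differentiation; every $A\in\mathcal W$ is strongly differentiable in $t\in[t_0,t_1]$ on $\mathcal D$, with derivative mapping $\mathcal D$ to $\mathcal D$, and $t\mapsto A(t)\xi(t)$ is real-analytic, for every solution $\xi$ as above, on each closed interval $[a,b]$ on which the control is analytic (meaning that $u$ agrees on $[a,b)$ with a function analytic on $[a,b]$). The output is *decoupled from (invariant under)* $H_{SB}$ if for every $u\in\mathcal U$, every initial time $s\in[t_0,t_1]$ and every unit vector $\xi_0\in\mathcal D$, the solution $\xi$ with the given $H_{SB}$ and the solution $\eta$ with $H_{SB}$ replaced by $0$,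 both starting at $\xi_0$ at time $s$, satisfy $\langle\xi(t)|C(t)|\xi(t)\rangle=\langle\eta(t)|C(t)|\eta(t)\rangle$ for all $t\in[s,t_1]$. For operator families put $\mathrm{ad}_H X=[X,H]=XH-HX$, identify operators on $\mathcal H_s$ with their extensions $\cdot\otimes 1$, and let $\mathcal C_0=\{C\}$ and, for $n\ge1$, $$\tilde C_n=\mathrm{span}_{\mathbb R}\{\mathrm{ad}^j_{H_i}X : X\in\mathcal C_{n-1},\ j=0,1,\dots,\ i=1,\dots,r\},$$ $$\mathcal C_n=\Big\{\big(\mathrm{ad}_{H_0}+\tfrac{\partial}{\partial t}\big)^jX : X\in\tilde C_n,\ j=0,1,\dots\Big\}.$$ Let the distribution $\tilde{\mathcal C}(t)$ be the real linear span of the values at time $t$ of all elements of $\mathcal C_1,\mathcal C_2,\dots$. **Theorem.** The output $y$ is decoupled from $H_{SB}$ if and only if $[T,H_{SB}(t)]=0$ on $\mathcal D$ for all $t\in[t_0,t_1]$ and all $T\in\tilde{\mathcal C}(t)$, that is, $[\tilde{\mathcal C}(t),H_{SB}(t)]=0$. -/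

import Mathlib

open scoped TensorProduct

noncomputable section

namespace OpenQuantum

/-- The Hilbert space tensor product of two complex Hilbert spaces: the completion of the algebraic
tensor product for the inner product `⟪a ⊗ b, c ⊗ d⟫ = ⟪a, c⟫ * ⟪b, d⟫`. -/
def HilbertTensor (S E : Type*) [NormedAddCommGroup S] [InnerProductSpace ℂ S]
    [NormedAddCommGroup E] [InnerProductSpace ℂ E] : Type _ :=
  UniformSpace.Completion (S ⊗[ℂ] E)

section HilbertTensor

variable {S E : Type*} [NormedAddCommGroup S] [InnerProductSpace ℂ S]
  [NormedAddCommGroup E] [InnerProductSpace ℂ E]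

instance : NormedAddCommGroup (HilbertTensor S E) :=
  inferInstanceAs (NormedAddCommGroup (UniformSpace.Completion (S ⊗[ℂ] E)))

instance : InnerProductSpace ℂ (HilbertTensor S E) :=
  inferInstanceAs (InnerProductSpace ℂ (UniformSpace.Completion (S ⊗[ℂ] E)))

instance : CompleteSpace (HilbertTensor S E) :=
  inferInstanceAs (CompleteSpace (UniformSpace.Completion (S ⊗[ℂ] E)))

/-- The product state `φ ⊗ χ` in the Hilbert space tensor product. -/
def productState (φ : S) (χ : E) : HilbertTensor S E :=
  ((φ ⊗ₜ[ℂ] χ : S ⊗[ℂ] E) : UniformSpace.Completion (S ⊗[ℂ] E))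

end HilbertTensor

section Domain

variable {K : Type*} [NormedAddCommGroup K] [InnerProductSpace ℂ K]

/-- Time-dependent, possibly unbounded, linear operators with the fixed invariant domain `D`. -/
abbrev OpFamily (D : Submodule ℂ K) : Type _ := ℝ → Module.End ℂ D

/-- `A` and `B` are formally adjoint to each other on the domain `D`. -/
def FormalAdjoint {D : Submodule ℂ K} (A B : Module.End ℂ D) : Prop :=
  ∀ ξ η : D, inner ℂ ((A ξ : D) : K) (η : K) = inner ℂ (ξ : K) ((B η : D) : K)

/-- `A` is skew-Hermitian on the domain `D`. -/
def SkewHermitian {D : Submodule ℂ K} (A : Module.End ℂ D) : Prop :=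
  FormalAdjoint A (-A)

/-- `B` is the strong derivative on `D` at time `t` of the operator family `A`, the time variable
running through `[t₀, t₁]`. -/
def HasOpDerivAt {D : Submodule ℂ K} (t₀ t₁ : ℝ) (A : OpFamily D) (B : Module.End ℂ D)
    (t : ℝ) : Prop :=
  ∀ ξ : D, HasDerivWithinAt (fun τ => ((A τ ξ : D) : K)) ((B ξ : D) : K) (Set.Icc t₀ t₁) t

open Classical in
/-- The strong time derivative `∂A/∂t` of an operator family over `[t₀, t₁]`
(zero where it does not exist and outside of `[t₀, t₁]`). -/
def opDeriv {D : Submodule ℂ K} (t₀ t₁ : ℝ) (A : OpFamily D) : OpFamily D := fun t =>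
  if h : t ∈ Set.Icc t₀ t₁ ∧ ∃ B : Module.End ℂ D, HasOpDerivAt t₀ t₁ A B t
  then Classical.choose h.2 else 0

/-- `ad_H X = [X, H]`, pointwise in time. -/
def ad {D : Submodule ℂ K} (H X : OpFamily D) : OpFamily D := fun t => X t * H t - H t * X t

end Domain

section Tensor

variable {S E : Type*} [NormedAddCommGroup S] [InnerProductSpace ℂ S]
  [NormedAddCommGroup E] [InnerProductSpace ℂ E]

/-- `A` acts on the system factor only, that is, `A = a ⊗ 1` for an operator `a` with the invariant
domain `domS`. -/
def IsSystemOperator (domS : Submodule ℂ S) (domE : Submodule ℂ E)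
    {D : Submodule ℂ (HilbertTensor S E)} (A : Module.End ℂ D) : Prop :=
  ∃ a : Module.End ℂ domS, ∀ (φ : domS) (χ : domE) (ξ : D),
    (ξ : HilbertTensor S E) = productState (φ : S) (χ : E) →
      ((A ξ : D) : HilbertTensor S E) = productState ((a φ : domS) : S) (χ : E)

/-- `A` acts on the environment factor only, that is, `A = 1 ⊗ a` for an operator `a` with the
invariant domain `domE`. -/
def IsEnvironmentOperator (domS : Submodule ℂ S) (domE : Submodule ℂ E)
    {D : Submodule ℂ (HilbertTensor S E)} (A : Module.End ℂ D) : Prop :=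
  ∃ a : Module.End ℂ domE, ∀ (φ : domS) (χ : domE) (ξ : D),
    (ξ : HilbertTensor S E) = productState (φ : S) (χ : E) →
      ((A ξ : D) : HilbertTensor S E) = productState (φ : S) ((a χ : domE) : E)

end Tensor

/-- A time-varying open quantum control system with output, over the time interval `[t₀, t₁]`, with
system Hilbert space `S`, environment Hilbert space `E` and `r` controls.  The operators may be
unbounded; they are defined on a common dense invariant domain `dom` of the tensor product, and
`H₀`, `Hc i`, `C` stand for the operators `H₀ ⊗ 1`, `H_i ⊗ 1`, `C ⊗ 1`, while `He` stands for
`1 ⊗ H_e`. -/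
structure ControlSystem (S E : Type*) [NormedAddCommGroup S] [InnerProductSpace ℂ S]
    [NormedAddCommGroup E] [InnerProductSpace ℂ E] (r : ℕ) where
  /-- initial time of the time interval -/
  t₀ : ℝ
  /-- final time of the time interval -/
  t₁ : ℝ
  lt : t₀ < t₁
  /-- domain of the operators on the system space -/
  domS : Submodule ℂ S
  /-- domain of the operators on the environment space -/
  domE : Submodule ℂ E
  /-- domain of the operators on the tensor product, on which the dynamics takes place -/
  dom : Submodule ℂ (HilbertTensor S E)
  dense_domS : Dense (domS : Set S)
  dense_domE : Dense (domE : Set E)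
  productState_mem : ∀ φ ∈ domS, ∀ χ ∈ domE, productState φ χ ∈ dom
  /-- drift Hamiltonian of the system -/
  H₀ : OpFamily dom
  /-- control Hamiltonians of the system -/
  Hc : Fin r → OpFamily dom
  /-- drift Hamiltonian of the environment -/
  He : OpFamily dom
  /-- interaction Hamiltonian -/
  HSB : OpFamily dom
  /-- the observed operator, not necessarily Hermitian -/
  C : OpFamily dom
  /-- the adjoint of `C` -/
  Cadj : OpFamily dom
  skew_H₀ : ∀ t, SkewHermitian (H₀ t)
  skew_Hc : ∀ i t, SkewHermitian (Hc i t)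
  skew_He : ∀ t, SkewHermitian (He t)
  skew_HSB : ∀ t, SkewHermitian (HSB t)
  adjoint_C : ∀ t, FormalAdjoint (C t) (Cadj t)
  system_H₀ : ∀ t, IsSystemOperator domS domE (H₀ t)
  system_Hc : ∀ i t, IsSystemOperator domS domE (Hc i t)
  system_C : ∀ t, IsSystemOperator domS domE (C t)
  system_Cadj : ∀ t, IsSystemOperator domS domE (Cadj t)
  environment_He : ∀ t, IsEnvironmentOperator domS domE (He t)

/-- `u` is piecewise constant with values in `U`: there are finitely many breakpoints, and `u` is
constant on each interval `[a, b)` between consecutive ones. -/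
def IsPiecewiseConstant {r : ℕ} (U : Set (Fin r → ℝ)) (u : ℝ → Fin r → ℝ) : Prop :=
  (∀ t, u t ∈ U) ∧
    ∃ P : Finset ℝ, ∀ a b : ℝ, a ≤ b → (∀ p ∈ P, p ∉ Set.Ioc a b) → u a = u b

/-- `u` is real-analytic on `[a, b)`, analytically up to the end point `b`. -/
def IsAnalyticPiece {r : ℕ} (u : ℝ → Fin r → ℝ) (a b : ℝ) : Prop :=
  ∃ g : ℝ → Fin r → ℝ, AnalyticOn ℝ g (Set.Icc a b) ∧ Set.EqOn u g (Set.Ico a b)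

/-- `u` is piecewise analytic on `[t₀, t₁]`. -/
def IsPiecewiseAnalytic {r : ℕ} (t₀ t₁ : ℝ) (u : ℝ → Fin r → ℝ) : Prop :=
  ∃ P : Finset ℝ, ∀ a b : ℝ, t₀ ≤ a → a < b → b ≤ t₁ → (∀ p ∈ P, p ∉ Set.Ioo a b) →
    IsAnalyticPiece u a b

/-- A class of admissible controls over `[t₀, t₁]`: all of them are piecewise analytic, and every
piecewise constant control with values in `U` is among them, for some set `U` of control values that
is not contained in a proper affine subspace of `ℝ^r`. -/
def IsAdmissibleClass {r : ℕ} (t₀ t₁ : ℝ) (𝒰 : Set (ℝ → Fin r → ℝ)) : Prop :=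
  (∀ u ∈ 𝒰, IsPiecewiseAnalytic t₀ t₁ u) ∧
    ∃ U : Set (Fin r → ℝ), affineSpan ℝ U = ⊤ ∧
      ∀ u : ℝ → Fin r → ℝ, IsPiecewiseConstant U u → u ∈ 𝒰

namespace ControlSystem

variable {S E : Type*} [NormedAddCommGroup S] [InnerProductSpace ℂ S]
  [NormedAddCommGroup E] [InnerProductSpace ℂ E] {r : ℕ}

/-- The time derivative of an operator family of the control system `Q`. -/
def deriv (Q : ControlSystem S E r) (A : OpFamily Q.dom) : OpFamily Q.dom :=
  opDeriv Q.t₀ Q.t₁ A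

/-- The total generator `H₀ ⊗ 1 + 1 ⊗ H_e + W + ∑ i, u_i H_i ⊗ 1` for the control `u` and the
interaction `W`. -/
def generator (Q : ControlSystem S E r) (W : OpFamily Q.dom) (u : ℝ → Fin r → ℝ) :
    OpFamily Q.dom := fun t =>
  Q.H₀ t + Q.He t + W t + ∑ i, ((u t i : ℝ) : ℂ) • Q.Hc i t

/-- `ξ` solves the Schrödinger equation with interaction `W` and control `u` on `[s, t₁]`: it is
norm continuous and its right derivative at each time is given by the generator. -/
def IsSolution (Q : ControlSystem S E r) (W : OpFamily Q.dom) (u : ℝ → Fin r → ℝ) (s : ℝ)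
    (ξ : ℝ → Q.dom) : Prop :=
  ContinuousOn (fun t => (ξ t : HilbertTensor S E)) (Set.Icc s Q.t₁) ∧
    ∀ t ∈ Set.Ico s Q.t₁,
      HasDerivWithinAt (fun τ => (ξ τ : HilbertTensor S E))
        ((Q.generator W u t (ξ t) : Q.dom) : HilbertTensor S E) (Set.Ici t) t

/-- The output `⟨ξ|C(t)|ξ⟩`. -/
def output (Q : ControlSystem S E r) (t : ℝ) (ξ : Q.dom) : ℂ :=
  inner ℂ (ξ : HilbertTensor S E) ((Q.C t ξ : Q.dom) : HilbertTensor S E)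

/-- The system evolves on its domain: for each admissible control, each initial time and each
initial state in the domain the Schrödinger equation has a solution up to time `t₁` in the
domain, both with the interaction Hamiltonian and without it. -/
def IsWellPosed (Q : ControlSystem S E r) (𝒰 : Set (ℝ → Fin r → ℝ)) : Prop :=
  ∀ W : OpFamily Q.dom, (W = Q.HSB ∨ W = 0) → ∀ u ∈ 𝒰, ∀ s ∈ Set.Icc Q.t₀ Q.t₁, ∀ ξ₀ : Q.dom,
    ∃ ξ : ℝ → Q.dom, Q.IsSolution W u s ξ ∧ ξ s = ξ₀

/-- The operator families formed from the Hamiltonians and the observed operator (and its adjoint)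
by composition and time differentiation. -/
inductive IsWord (Q : ControlSystem S E r) : OpFamily Q.dom → Prop
  | one : IsWord Q 1
  | drift : IsWord Q Q.H₀
  | control (i : Fin r) : IsWord Q (Q.Hc i)
  | environment : IsWord Q Q.He
  | interaction : IsWord Q Q.HSB
  | observable : IsWord Q Q.C
  | observableAdj : IsWord Q Q.Cadj
  | mul {A B : OpFamily Q.dom} : IsWord Q A → IsWord Q B → IsWord Q (A * B)
  | deriv {A : OpFamily Q.dom} : IsWord Q A → IsWord Q (Q.deriv A)

/-- The system is analytic: the Hamiltonians and the observed operator are infinitely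
differentiable in time on the domain, and the domain consists of analytic vectors, which means that
each composition of these operators and their time derivatives is real-analytic in time along
each trajectory (with or without interaction), wherever the control is. -/
def IsAnalyticSystem (Q : ControlSystem S E r) (𝒰 : Set (ℝ → Fin r → ℝ)) : Prop :=
  (∀ A : OpFamily Q.dom, Q.IsWord A → ∀ t ∈ Set.Icc Q.t₀ Q.t₁,
      ∃ B : Module.End ℂ Q.dom, HasOpDerivAt Q.t₀ Q.t₁ A B t) ∧
    ∀ W : OpFamily Q.dom, (W = Q.HSB ∨ W = 0) → ∀ u ∈ 𝒰, ∀ s ∈ Set.Icc Q.t₀ Q.t₁,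
      ∀ ξ : ℝ → Q.dom, Q.IsSolution W u s ξ →
        ∀ a b : ℝ, s ≤ a → a < b → b ≤ Q.t₁ → IsAnalyticPiece u a b →
          ∀ A : OpFamily Q.dom, Q.IsWord A →
            AnalyticOn ℝ (fun t => ((A t (ξ t) : Q.dom) : HilbertTensor S E)) (Set.Icc a b)

/-- The output is decoupled from the environment, that is, invariant under the interaction
Hamiltonian: whatever the admissible control, the initial time and the initial state (a unit vector
in the domain), the output is the same with the interaction Hamiltonian and without it. -/
def IsDecoupled (Q : ControlSystem S E r) (𝒰 : Set (ℝ → Fin r → ℝ)) : Prop :=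
  ∀ u ∈ 𝒰, ∀ s ∈ Set.Icc Q.t₀ Q.t₁, ∀ ξ₀ : Q.dom, ‖(ξ₀ : HilbertTensor S E)‖ = 1 →
    ∀ ξ η : ℝ → Q.dom, Q.IsSolution Q.HSB u s ξ → ξ s = ξ₀ → Q.IsSolution 0 u s η → η s = ξ₀ →
      ∀ t ∈ Set.Icc s Q.t₁, Q.output t (ξ t) = Q.output t (η t)

/-- `span {ad_{H_i}^j X | X ∈ 𝒳, j = 0, 1, …, i = 1, …, r}`. -/
def controlSpan (Q : ControlSystem S E r) (𝒳 : Set (OpFamily Q.dom)) :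
    Submodule ℝ (OpFamily Q.dom) :=
  Submodule.span ℝ {Y | ∃ (i : Fin r) (j : ℕ), ∃ X ∈ 𝒳, Y = (ad (Q.Hc i))^[j] X}

/-- The operator `ad_{H₀} + ∂/∂t`. -/
def driftStep (Q : ControlSystem S E r) (X : OpFamily Q.dom) : OpFamily Q.dom :=
  ad Q.H₀ X + Q.deriv X

/-- The sets `𝒞_n`: starting with `𝒞_0 = {C}`, the next set consists of all
`(ad_{H₀} + ∂/∂t)^j X` with `X` in the span of the `ad_{H_i}^k` applied to the previous set. -/
def calC (Q : ControlSystem S E r) : ℕ → Set (OpFamily Q.dom)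
  | 0 => {Q.C}
  | n + 1 => {Y | ∃ j : ℕ, ∃ X ∈ Q.controlSpan (Q.calC n), Y = Q.driftStep^[j] X}

/-- The distribution `𝒞̃(t)` generated by `𝒞_1, 𝒞_2, …`. -/
def distribution (Q : ControlSystem S E r) (t : ℝ) : Submodule ℝ (Module.End ℂ Q.dom) :=
  Submodule.span ℝ {T | ∃ n : ℕ, ∃ X ∈ Q.calC (n + 1), T = X t}

end ControlSystem

end OpenQuantum

end

noncomputable section

namespace OpenQuantum

/-! ### Formal adjoints, expectation values and strong derivatives -/

section Domain

variable {K : Type*} [NormedAddCommGroup K] [InnerProductSpace ℂ K] {D : Submodule ℂ K}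

/-! Everything rests on the Ehrenfest equation `IsAnalyticSystem.hasDerivWithinAt_expVal`: for a
family `X` that commutes with `He`, the right derivative of `⟨X⟩` is `⟨driftStep X⟩ + ∑ u_i ⟨ad H_i
X⟩ + ⟨ad HSB X⟩`.

If all iterated brackets commute with `HSB`, the last term drops out. The differences of the
expectation values with and without interaction, indexed by the elements of the sets `calC (n + 1)`,
then solve a closed homogeneous linear system with zero initial data. The system is infinite, so
uniqueness is not automatic: repeated integration only shows that each difference is `O((t - a)^k)`
for every `k` (`flat_of_linear_system`). Analyticity turns this flatness into vanishing
(`eqOn_zero_of_flat`), and the pieces of the control are chained by `rel_of_pieces`.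

Conversely, consider the families whose expectation values ignore the interaction. Differentiating
at the initial time, where both states agree, gives `ad HSB X = 0` (`ad_HSB_eq_zero`).
Differentiating at a later time, after switching the control there to an arbitrary `v ∈ U`, gives an
affine function of `v` that vanishes on `U`; its coefficients vanish, so `driftStep X` and each `ad
H_i X` are again such families (`driftStep_ad_mem_invariantSpan`). Starting from `C`, this reaches
every `calC n`. -/

theorem FormalAdjoint.symm {A B : Module.End ℂ D} (h : FormalAdjoint A B) :
    FormalAdjoint B A := fun ξ η => by
  rw [← inner_conj_symm, ← h η ξ, inner_conj_symm]

theorem FormalAdjoint.zero : FormalAdjoint (0 : Module.End ℂ D) 0 := fun ξ η => by simp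

theorem FormalAdjoint.one : FormalAdjoint (1 : Module.End ℂ D) 1 := fun _ _ => rfl

theorem FormalAdjoint.add {A A' B B' : Module.End ℂ D} (h : FormalAdjoint A B)
    (h' : FormalAdjoint A' B') : FormalAdjoint (A + A') (B + B') := fun ξ η => by
  simp only [LinearMap.add_apply, Submodule.coe_add, inner_add_left, inner_add_right, h ξ η,
    h' ξ η]

theorem FormalAdjoint.real_smul {A B : Module.End ℂ D} (h : FormalAdjoint A B) (c : ℝ) :
    FormalAdjoint (c • A) (c • B) := fun ξ η => by
  change inner ℂ ((c : ℂ) • ((A ξ : D) : K)) _ = inner ℂ _ ((c : ℂ) • ((B η : D) : K))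
  rw [inner_smul_left, inner_smul_right, h ξ η, Complex.conj_ofReal]

theorem FormalAdjoint.mul {A A' B B' : Module.End ℂ D} (h : FormalAdjoint A B)
    (h' : FormalAdjoint A' B') : FormalAdjoint (A * A') (B' * B) := fun ξ η => by
  rw [Module.End.mul_apply, Module.End.mul_apply, h, h']

theorem SkewHermitian.zero : SkewHermitian (0 : Module.End ℂ D) := fun ξ η => by simp

theorem SkewHermitian.add {A B : Module.End ℂ D} (hA : SkewHermitian A) (hB : SkewHermitian B) :
    SkewHermitian (A + B) := by
  have := FormalAdjoint.add hA hB
  rwa [← neg_add] at this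

theorem SkewHermitian.real_smul {A : Module.End ℂ D} (hA : SkewHermitian A) (c : ℝ) :
    SkewHermitian ((c : ℂ) • A) := by
  have := FormalAdjoint.real_smul hA c
  rwa [smul_neg] at this

theorem SkewHermitian.sum {ι : Type*} {s : Finset ι} {A : ι → Module.End ℂ D}
    (hA : ∀ i ∈ s, SkewHermitian (A i)) : SkewHermitian (∑ i ∈ s, A i) :=
  Finset.sum_induction A SkewHermitian (fun _ _ => SkewHermitian.add) SkewHermitian.zero hA

theorem SkewHermitian.inner_apply {A : Module.End ℂ D} (hA : SkewHermitian A) (ξ η : D) :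
    inner ℂ ((A ξ : D) : K) (η : K) = -inner ℂ (ξ : K) ((A η : D) : K) := by
  rw [hA ξ η, LinearMap.neg_apply, Submodule.coe_neg, inner_neg_right]

/-- The expectation value `⟨ξ|A|ξ⟩`. -/
def expVal (A : Module.End ℂ D) (ξ : D) : ℂ := inner ℂ (ξ : K) ((A ξ : D) : K)

theorem expVal_add (A B : Module.End ℂ D) (ξ : D) : expVal (A + B) ξ = expVal A ξ + expVal B ξ := by
  simp only [expVal, LinearMap.add_apply, Submodule.coe_add, inner_add_right]

theorem expVal_smul (c : ℂ) (A : Module.End ℂ D) (ξ : D) : expVal (c • A) ξ = c * expVal A ξ := by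
  simp only [expVal, LinearMap.smul_apply, Submodule.coe_smul, inner_smul_right]

theorem expVal_real_smul (c : ℝ) (A : Module.End ℂ D) (ξ : D) :
    expVal (c • A) ξ = c * expVal A ξ :=
  expVal_smul (c : ℂ) A ξ

@[simp] theorem expVal_zero (ξ : D) : expVal (0 : Module.End ℂ D) ξ = 0 := by simp [expVal]

theorem expVal_sum {ι : Type*} (s : Finset ι) (A : ι → Module.End ℂ D) (ξ : D) :
    expVal (∑ i ∈ s, A i) ξ = ∑ i ∈ s, expVal (A i) ξ := by
  simp only [expVal, LinearMap.sum_apply, Submodule.coe_sum, inner_sum]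

/-- An operator all of whose expectation values in unit vectors vanish is zero. -/
theorem eq_zero_of_expVal_eq_zero {A : Module.End ℂ D}
    (h : ∀ ξ : D, ‖(ξ : K)‖ = 1 → expVal A ξ = 0) : A = 0 := by
  -- Complex polarization: no Hermiticity of `A` is needed.
  rw [← inner_map_self_eq_zero]
  intro ξ
  rw [← inner_conj_symm, map_eq_zero]
  by_cases hξ : ξ = 0
  · simp [hξ]
  have hn : (‖(ξ : K)‖ : ℂ) ≠ 0 := by simpa using hξ
  have h1 := h ((‖(ξ : K)‖⁻¹ : ℂ) • ξ) (by
    rw [Submodule.coe_smul, norm_smul, norm_inv, Complex.norm_real, norm_norm]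
    exact inv_mul_cancel₀ (by simpa using hξ))
  rw [expVal, map_smul, Submodule.coe_smul, Submodule.coe_smul, inner_smul_left,
    inner_smul_right] at h1
  simpa [hn, hξ] using h1

variable {t₀ t₁ t : ℝ} {A B : OpFamily D} {A' B' : Module.End ℂ D}

theorem HasOpDerivAt.unique (hlt : t₀ < t₁) (ht : t ∈ Set.Icc t₀ t₁) (h : HasOpDerivAt t₀ t₁ A A' t)
    (h' : HasOpDerivAt t₀ t₁ A B' t) : A' = B' :=
  LinearMap.ext fun ξ => Subtype.ext
    (UniqueDiffWithinAt.eq_deriv _ (uniqueDiffOn_Icc hlt t ht) (h ξ) (h' ξ))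

theorem HasOpDerivAt.add (h : HasOpDerivAt t₀ t₁ A A' t) (h' : HasOpDerivAt t₀ t₁ B B' t) :
    HasOpDerivAt t₀ t₁ (A + B) (A' + B') t := fun ξ => (h ξ).add (h' ξ)

theorem HasOpDerivAt.real_smul (h : HasOpDerivAt t₀ t₁ A A' t) (c : ℝ) :
    HasOpDerivAt t₀ t₁ (c • A) (c • A') t := fun ξ => (h ξ).const_smul c

theorem HasOpDerivAt.zero : HasOpDerivAt t₀ t₁ (0 : OpFamily D) 0 t := fun _ =>
  hasDerivWithinAt_const _ _ _

theorem opDeriv_spec (ht : t ∈ Set.Icc t₀ t₁) (h : ∃ B, HasOpDerivAt t₀ t₁ A B t) :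
    HasOpDerivAt t₀ t₁ A (opDeriv t₀ t₁ A t) t := by
  rw [opDeriv, dif_pos ⟨ht, h⟩]
  exact Classical.choose_spec h

theorem opDeriv_of_notMem (ht : t ∉ Set.Icc t₀ t₁) : opDeriv t₀ t₁ A t = 0 := by
  rw [opDeriv, dif_neg fun h => ht h.1]

/-- The strong derivative is determined by the strong derivatives at the times in `[t₀, t₁]`. -/
theorem opDeriv_eq (hlt : t₀ < t₁) (h : ∀ t ∈ Set.Icc t₀ t₁, HasOpDerivAt t₀ t₁ A (B t) t)
    (hB : ∀ t ∉ Set.Icc t₀ t₁, B t = 0) : opDeriv t₀ t₁ A = B := by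
  funext t
  by_cases ht : t ∈ Set.Icc t₀ t₁
  · exact (opDeriv_spec ht ⟨_, h t ht⟩).unique hlt ht (h t ht)
  · rw [opDeriv_of_notMem ht, hB t ht]

/-- Strong derivatives of formally adjoint families are formally adjoint. -/
theorem FormalAdjoint.of_hasOpDerivAt (hlt : t₀ < t₁) (ht : t ∈ Set.Icc t₀ t₁)
    (h : ∀ τ, FormalAdjoint (A τ) (B τ)) (hA : HasOpDerivAt t₀ t₁ A A' t)
    (hB : HasOpDerivAt t₀ t₁ B B' t) : FormalAdjoint A' B' := fun ξ η => by
  have h1 := (hA ξ).inner ℂ (hasDerivWithinAt_const t (Set.Icc t₀ t₁) (η : K))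
  have h2 := (hasDerivWithinAt_const t (Set.Icc t₀ t₁) (ξ : K)).inner ℂ (hB η)
  simp only [h _ ξ η] at h1
  simpa using UniqueDiffWithinAt.eq_deriv _ (uniqueDiffOn_Icc hlt t ht) h1 h2

/-- An operator that commutes with a family also commutes with the strong derivative, provided it
has a formal adjoint. -/
theorem HasOpDerivAt.commute (hD : Dense (D : Set K)) (hlt : t₀ < t₁) (ht : t ∈ Set.Icc t₀ t₁)
    (hA : HasOpDerivAt t₀ t₁ A A' t) {X Y : Module.End ℂ D} (hXY : FormalAdjoint X Y)
    (hc : ∀ τ, Commute (A τ) X) : Commute A' X := by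
  refine LinearMap.ext fun ξ => Subtype.ext (hD.eq_of_inner_left ℂ fun η hη => ?_)
  -- `X` may be unbounded and cannot be pulled through the limit, so it is moved to the fixed vector
  -- `η` as its adjoint `Y`.
  have h1 := (hA (X ξ)).inner ℂ (hasDerivWithinAt_const t (Set.Icc t₀ t₁) η)
  have h2 := (hA ξ).inner ℂ (hasDerivWithinAt_const t (Set.Icc t₀ t₁) ((Y ⟨η, hη⟩ : D) : K))
  have h3 : ∀ τ, inner ℂ ((A τ (X ξ) : D) : K) η
      = inner ℂ ((A τ ξ : D) : K) ((Y ⟨η, hη⟩ : D) : K) := fun τ => by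
    rw [← hXY, ← Module.End.mul_apply, ← Module.End.mul_apply, hc τ]
  simp only [h3] at h1
  have := UniqueDiffWithinAt.eq_deriv _ (uniqueDiffOn_Icc hlt t ht) h1 h2
  simpa only [inner_zero_right, zero_add, Module.End.mul_apply, hXY (A' ξ) ⟨η, hη⟩] using this

theorem ad_apply (H X : OpFamily D) (t : ℝ) : ad H X t = X t * H t - H t * X t := rfl

theorem ad_eq (H X : OpFamily D) : ad H X = X * H - H * X := rfl

end Domain

/-! ### Product states and operators on one tensor factor -/

section Tensor

variable {S E : Type*} [NormedAddCommGroup S] [InnerProductSpace ℂ S]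
  [NormedAddCommGroup E] [InnerProductSpace ℂ E]

theorem continuous_productState :
    Continuous fun p : S × E => (productState p.1 p.2 : HilbertTensor S E) :=
  (UniformSpace.Completion.continuous_coe (S ⊗[ℂ] E)).comp TensorProduct.continuous_tmul

/-- Product states of vectors from dense domains are total. -/
theorem dense_span_productState {domS : Submodule ℂ S} {domE : Submodule ℂ E}
    (hS : Dense (domS : Set S)) (hE : Dense (domE : Set E)) :
    Dense (Submodule.span ℂ {x : HilbertTensor S E | ∃ φ ∈ domS, ∃ χ ∈ domE,
      x = productState φ χ} : Set (HilbertTensor S E)) := by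
  set P := Submodule.span ℂ {x : HilbertTensor S E | ∃ φ ∈ domS, ∃ χ ∈ domE, x = productState φ χ}
  have hprod : ∀ φ χ, (productState φ χ : HilbertTensor S E) ∈ P.topologicalClosure := fun φ χ => by
    have hd : (φ, χ) ∈ closure ((domS : Set S) ×ˢ (domE : Set E)) := (hS.prod hE) (φ, χ)
    exact map_mem_closure (f := fun p : S × E => productState p.1 p.2)
      continuous_productState hd fun p hp =>
      Submodule.subset_span ⟨p.1, hp.1, p.2, hp.2, rfl⟩
  have hcoe : ∀ x : S ⊗[ℂ] E,
      ((x : UniformSpace.Completion (S ⊗[ℂ] E)) : HilbertTensor S E) ∈ P.topologicalClosure := by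
    intro x
    induction x with
    | zero => exact UniformSpace.Completion.coe_zero (α := S ⊗[ℂ] E) ▸ zero_mem _
    | tmul φ χ => exact hprod φ χ
    | add x y hx hy => exact UniformSpace.Completion.coe_add x y ▸ add_mem hx hy
  intro x
  have hx : x ∈ closure (Set.range ((↑) : S ⊗[ℂ] E → UniformSpace.Completion (S ⊗[ℂ] E))) :=
    UniformSpace.Completion.denseRange_coe x
  exact closure_minimal (Set.range_subset_iff.2 hcoe) P.isClosed_topologicalClosure hx

end Tensor

namespace ControlSystem

variable {S E : Type*} [NormedAddCommGroup S] [InnerProductSpace ℂ S]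
  [NormedAddCommGroup E] [InnerProductSpace ℂ E] {r : ℕ} (Q : ControlSystem S E r)

theorem dense_dom : Dense (Q.dom : Set (HilbertTensor S E)) :=
  (dense_span_productState Q.dense_domS Q.dense_domE).mono <| Submodule.span_le.2 <| by
    rintro x ⟨φ, hφ, χ, hχ, rfl⟩
    exact Q.productState_mem φ hφ χ hχ

/-- Two operators on the domain with formal adjoints agree if their adjoints agree on the product
states. -/
theorem eq_of_adjoint_eqOn_productState {A A' B B' : Module.End ℂ Q.dom} (hA : FormalAdjoint A A')
    (hB : FormalAdjoint B B')
    (h : ∀ (φ : Q.domS) (χ : Q.domE) (ξ : Q.dom),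
      (ξ : HilbertTensor S E) = productState (φ : S) (χ : E) → A' ξ = B' ξ) : A = B := by
  refine LinearMap.ext fun ξ => Subtype.ext ?_
  -- Equality on product states would not determine an unbounded operator on `dom`. Testing its
  -- values against product states does, which is why the hypothesis concerns the adjoints.
  refine (dense_span_productState Q.dense_domS Q.dense_domE).eq_of_inner_left ℂ fun v hv => ?_
  induction hv using Submodule.span_induction with
  | mem x hx =>
    obtain ⟨φ, hφ, χ, hχ, rfl⟩ := hx
    have := h ⟨φ, hφ⟩ ⟨χ, hχ⟩ ⟨_, Q.productState_mem φ hφ χ hχ⟩ rfl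
    rw [show productState φ χ = ((⟨_, Q.productState_mem φ hφ χ hχ⟩ : Q.dom) : HilbertTensor S E)
      from rfl, hA, hB, this]
  | zero => simp
  | add x y _ _ hx hy => rw [inner_add_right, inner_add_right, hx, hy]
  | smul c x _ hx => rw [inner_smul_right, inner_smul_right, hx]

/-- An operator whose formal adjoint acts on the system only commutes with the Hamiltonian of the
environment. -/
theorem commute_He_of_adjoint {A A' : Module.End ℂ Q.dom} (hA : FormalAdjoint A A')
    (hA' : IsSystemOperator Q.domS Q.domE A') (t : ℝ) : Commute A (Q.He t) := by
  have hH := Q.skew_He t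
  refine Q.eq_of_adjoint_eqOn_productState (hA.mul hH) (hH.mul hA) fun φ χ ξ hξ => ?_
  obtain ⟨a, ha⟩ := hA'
  obtain ⟨b, hb⟩ := Q.environment_He t
  have h1 := ha φ χ ξ hξ
  have h2 := hb φ χ ξ hξ
  simp only [Module.End.mul_apply, LinearMap.neg_apply, map_neg, neg_inj]
  -- Both orders give `aφ ⊗ bχ`.
  exact Subtype.ext ((hb (a φ) χ _ h1).trans (ha φ (b χ) _ h2).symm)

theorem isSystemOperator_neg {A : Module.End ℂ Q.dom} (hA : IsSystemOperator Q.domS Q.domE A) :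
    IsSystemOperator Q.domS Q.domE (-A) := by
  obtain ⟨a, ha⟩ := hA
  refine ⟨-a, fun φ χ ξ hξ => ?_⟩
  rw [LinearMap.neg_apply, LinearMap.neg_apply, Submodule.coe_neg, Submodule.coe_neg, ha φ χ ξ hξ,
    productState, productState, TensorProduct.neg_tmul, UniformSpace.Completion.coe_neg]
  rfl

theorem commute_He_of_skew {A : Module.End ℂ Q.dom} (hA : SkewHermitian A)
    (hA' : IsSystemOperator Q.domS Q.domE A) (t : ℝ) : Commute A (Q.He t) :=
  Q.commute_He_of_adjoint hA (Q.isSystemOperator_neg hA') t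

end ControlSystem

/-! ### Spans of words and their closure properties -/

namespace ControlSystem

variable {S E : Type*} [NormedAddCommGroup S] [InnerProductSpace ℂ S]
  [NormedAddCommGroup E] [InnerProductSpace ℂ E] {r : ℕ} (Q : ControlSystem S E r)

/-- The real span of the words in the operators of the control system. -/
def wordSpan : Submodule ℝ (OpFamily Q.dom) := Submodule.span ℝ {A | Q.IsWord A}

variable {Q} {A B : OpFamily Q.dom}

theorem IsWord.mem_wordSpan (h : Q.IsWord A) : A ∈ Q.wordSpan := Submodule.subset_span h

theorem mul_mem_wordSpan (hA : A ∈ Q.wordSpan) (hB : B ∈ Q.wordSpan) : A * B ∈ Q.wordSpan := by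
  induction hA, hB using Submodule.span_induction₂ with
  | mem_mem A B hA hB => exact (IsWord.mul hA hB).mem_wordSpan
  | zero_left B _ => rw [zero_mul]; exact zero_mem _
  | zero_right A _ => rw [mul_zero]; exact zero_mem _
  | add_left A B C _ _ _ h h' => rw [add_mul]; exact add_mem h h'
  | add_right A B C _ _ _ h h' => rw [mul_add]; exact add_mem h h'
  | smul_left c A B _ _ h => rw [smul_mul_assoc]; exact Submodule.smul_mem _ c h
  | smul_right c A B _ _ h => rw [mul_smul_comm]; exact Submodule.smul_mem _ c h

theorem ad_mem_wordSpan (hA : A ∈ Q.wordSpan) (hB : B ∈ Q.wordSpan) : ad A B ∈ Q.wordSpan := by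
  rw [ad_eq]
  exact sub_mem (mul_mem_wordSpan hB hA) (mul_mem_wordSpan hA hB)

section

variable (hd : ∀ A, Q.IsWord A → ∀ t ∈ Set.Icc Q.t₀ Q.t₁,
  ∃ B : Module.End ℂ Q.dom, HasOpDerivAt Q.t₀ Q.t₁ A B t)

include hd

theorem hasOpDerivAt_of_mem_wordSpan (hA : A ∈ Q.wordSpan) {t : ℝ} (ht : t ∈ Set.Icc Q.t₀ Q.t₁) :
    HasOpDerivAt Q.t₀ Q.t₁ A (Q.deriv A t) t := by
  refine opDeriv_spec ht ?_
  induction hA using Submodule.span_induction with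
  | mem A hA => exact hd A hA t ht
  | zero => exact ⟨0, HasOpDerivAt.zero⟩
  | add A B _ _ h h' =>
    obtain ⟨A', hA'⟩ := h
    obtain ⟨B', hB'⟩ := h'
    exact ⟨_, hA'.add hB'⟩
  | smul c A _ h =>
    obtain ⟨A', hA'⟩ := h
    exact ⟨_, hA'.real_smul c⟩

/-- Since `opDeriv` is zero where no derivative exists, linearity relies on the differentiability of
words. Outside `[t₀, t₁]` both sides take the default value. -/
theorem deriv_add (hA : A ∈ Q.wordSpan) (hB : B ∈ Q.wordSpan) :
    Q.deriv (A + B) = Q.deriv A + Q.deriv B :=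
  opDeriv_eq Q.lt (fun _ ht => (hasOpDerivAt_of_mem_wordSpan hd hA ht).add
    (hasOpDerivAt_of_mem_wordSpan hd hB ht)) fun t ht => by
      rw [Pi.add_apply, deriv, deriv, opDeriv_of_notMem ht, opDeriv_of_notMem ht, add_zero]

theorem deriv_smul (hA : A ∈ Q.wordSpan) (c : ℝ) : Q.deriv (c • A) = c • Q.deriv A :=
  opDeriv_eq Q.lt (fun _ ht => (hasOpDerivAt_of_mem_wordSpan hd hA ht).real_smul c)
    fun t ht => by rw [Pi.smul_apply, deriv, opDeriv_of_notMem ht, smul_zero]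

theorem deriv_zero : Q.deriv (0 : OpFamily Q.dom) = 0 := by
  simpa using deriv_smul hd (zero_mem Q.wordSpan) 0

theorem deriv_mem_wordSpan (hA : A ∈ Q.wordSpan) : Q.deriv A ∈ Q.wordSpan := by
  induction hA using Submodule.span_induction with
  | mem A hA => exact (IsWord.deriv hA).mem_wordSpan
  | zero => rw [deriv_zero hd]; exact zero_mem _
  | add A B hA hB h h' => rw [deriv_add hd hA hB]; exact add_mem h h'
  | smul c A hA h => rw [deriv_smul hd hA]; exact Submodule.smul_mem _ c h

theorem formalAdjoint_deriv (hA : A ∈ Q.wordSpan) (hB : B ∈ Q.wordSpan)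
    (h : ∀ t, FormalAdjoint (A t) (B t)) (t : ℝ) :
    FormalAdjoint (Q.deriv A t) (Q.deriv B t) := by
  by_cases ht : t ∈ Set.Icc Q.t₀ Q.t₁
  · exact FormalAdjoint.of_hasOpDerivAt Q.lt ht h (hasOpDerivAt_of_mem_wordSpan hd hA ht)
      (hasOpDerivAt_of_mem_wordSpan hd hB ht)
  · rw [deriv, deriv, opDeriv_of_notMem ht, opDeriv_of_notMem ht]
    exact FormalAdjoint.zero

/-- The generating operators are closed under adjoints up to sign, `Cadj` being among them; products
reverse and derivatives keep the adjoint relation. The adjoint is what makes a weak product rule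
possible in `IsSolution.hasDerivWithinAt_apply`. -/
theorem exists_formalAdjoint (hA : A ∈ Q.wordSpan) :
    ∃ A' ∈ Q.wordSpan, ∀ t, FormalAdjoint (A t) (A' t) := by
  induction hA using Submodule.span_induction with
  | mem A hA =>
    induction hA with
    | one => exact ⟨1, IsWord.one.mem_wordSpan, fun _ => FormalAdjoint.one⟩
    | drift => exact ⟨-Q.H₀, neg_mem IsWord.drift.mem_wordSpan, Q.skew_H₀⟩
    | control i => exact ⟨-Q.Hc i, neg_mem (IsWord.control i).mem_wordSpan, Q.skew_Hc i⟩
    | environment => exact ⟨-Q.He, neg_mem IsWord.environment.mem_wordSpan, Q.skew_He⟩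
    | interaction => exact ⟨-Q.HSB, neg_mem IsWord.interaction.mem_wordSpan, Q.skew_HSB⟩
    | observable => exact ⟨Q.Cadj, IsWord.observableAdj.mem_wordSpan, Q.adjoint_C⟩
    | observableAdj => exact ⟨Q.C, IsWord.observable.mem_wordSpan, fun t => (Q.adjoint_C t).symm⟩
    | mul _ _ ihA ihB =>
      obtain ⟨A', hA', h⟩ := ihA
      obtain ⟨B', hB', h'⟩ := ihB
      exact ⟨B' * A', mul_mem_wordSpan hB' hA', fun t => (h t).mul (h' t)⟩
    | deriv hA ih =>
      obtain ⟨A', hA', h⟩ := ih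
      exact ⟨_, deriv_mem_wordSpan hd hA', formalAdjoint_deriv hd hA.mem_wordSpan hA' h⟩
  | zero => exact ⟨0, zero_mem _, fun _ => FormalAdjoint.zero⟩
  | add A B _ _ ihA ihB =>
    obtain ⟨A', hA', h⟩ := ihA
    obtain ⟨B', hB', h'⟩ := ihB
    exact ⟨A' + B', add_mem hA' hB', fun t => (h t).add (h' t)⟩
  | smul c A _ ih =>
    obtain ⟨A', hA', h⟩ := ih
    exact ⟨c • A', Submodule.smul_mem _ c hA', fun t => (h t).real_smul c⟩

theorem driftStep_mem_wordSpan (hA : A ∈ Q.wordSpan) : Q.driftStep A ∈ Q.wordSpan :=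
  add_mem (ad_mem_wordSpan IsWord.drift.mem_wordSpan hA) (deriv_mem_wordSpan hd hA)

end

variable (Q) in
/-- Combinations of words that commute with the Hamiltonian of the environment at all times. -/
def systemSpan : Submodule ℝ (OpFamily Q.dom) where
  carrier := {A | A ∈ Q.wordSpan ∧ ∀ t t', Commute (A t) (Q.He t')}
  add_mem' := fun h h' => ⟨add_mem h.1 h'.1, fun t t' => (h.2 t t').add_left (h'.2 t t')⟩
  zero_mem' := ⟨zero_mem _, fun _ t' => Commute.zero_left (Q.He t')⟩
  smul_mem' := fun c _ h => ⟨Submodule.smul_mem _ c h.1, fun t t' => (h.2 t t').smul_left c⟩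

theorem C_mem_systemSpan : Q.C ∈ Q.systemSpan :=
  ⟨IsWord.observable.mem_wordSpan, fun t => Q.commute_He_of_adjoint (Q.adjoint_C t)
    (Q.system_Cadj t)⟩

theorem commute_ad {H X : OpFamily Q.dom} {t : ℝ} {Y : Module.End ℂ Q.dom} (hH : Commute (H t) Y)
    (hX : Commute (X t) Y) : Commute (ad H X t) Y :=
  (hX.mul_left hH).sub_left (hH.mul_left hX)

theorem ad_Hc_mem_systemSpan (hA : A ∈ Q.systemSpan) (i : Fin r) :
    ad (Q.Hc i) A ∈ Q.systemSpan :=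
  ⟨ad_mem_wordSpan (IsWord.control i).mem_wordSpan hA.1, fun t t' =>
    commute_ad (Q.commute_He_of_skew (Q.skew_Hc i t) (Q.system_Hc i t) t') (hA.2 t t')⟩

theorem driftStep_mem_systemSpan (hd : ∀ A, Q.IsWord A → ∀ t ∈ Set.Icc Q.t₀ Q.t₁,
    ∃ B : Module.End ℂ Q.dom, HasOpDerivAt Q.t₀ Q.t₁ A B t) (hA : A ∈ Q.systemSpan) :
    Q.driftStep A ∈ Q.systemSpan := by
  refine ⟨driftStep_mem_wordSpan hd hA.1, fun t t' => Commute.add_left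
    (commute_ad (Q.commute_He_of_skew (Q.skew_H₀ t) (Q.system_H₀ t) t') (hA.2 t t')) ?_⟩
  by_cases ht : t ∈ Set.Icc Q.t₀ Q.t₁
  · exact (hasOpDerivAt_of_mem_wordSpan hd hA.1 ht).commute Q.dense_dom Q.lt ht (Q.skew_He t')
      fun τ => hA.2 τ t'
  · rw [deriv, opDeriv_of_notMem ht]
    exact Commute.zero_left _

/-- A real space of operator families that contains the observable and is stable under the
brackets with the control Hamiltonians and under the drift step contains all the sets `𝒞_n`. -/
theorem calC_subset {M : Submodule ℝ (OpFamily Q.dom)} (hC : Q.C ∈ M)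
    (had : ∀ i, ∀ X ∈ M, ad (Q.Hc i) X ∈ M) (hdrift : ∀ X ∈ M, Q.driftStep X ∈ M) (n : ℕ) :
    Q.calC n ⊆ M := by
  have iter : ∀ f : OpFamily Q.dom → OpFamily Q.dom, (∀ X ∈ M, f X ∈ M) →
      ∀ (j : ℕ), ∀ X ∈ M, f^[j] X ∈ M := fun f hf j => by
    induction j with
    | zero => exact fun X hX => hX
    | succ j ih => exact fun X hX => ih _ (hf X hX)
  induction n with
  | zero => exact Set.singleton_subset_iff.2 hC
  | succ n ih =>
    rintro Y ⟨j, X, hX, rfl⟩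
    refine iter _ hdrift j X (Submodule.span_le.2 ?_ hX)
    rintro Z ⟨i, k, X, hX, rfl⟩
    exact iter _ (had i) k X (ih hX)

theorem ad_mem_calC {n : ℕ} (hA : A ∈ Q.calC n) (i : Fin r) : ad (Q.Hc i) A ∈ Q.calC (n + 1) :=
  ⟨0, _, Submodule.subset_span ⟨i, 1, A, hA, rfl⟩, rfl⟩

theorem driftStep_mem_calC {n : ℕ} (hA : A ∈ Q.calC (n + 1)) : Q.driftStep A ∈ Q.calC (n + 1) := by
  obtain ⟨j, X, hX, rfl⟩ := hA
  exact ⟨j + 1, X, hX, (Function.iterate_succ_apply' _ _ _).symm⟩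

/-- Both iteration counts are zero, but `controlSpan` still asks for a control index; hence `0 < r`.
-/
theorem C_mem_calC_one (hr : 0 < r) : Q.C ∈ Q.calC 1 :=
  ⟨0, _, Submodule.subset_span ⟨⟨0, hr⟩, 0, Q.C, rfl, rfl⟩, rfl⟩

/-- Commuting with the distribution amounts to commuting with the families that generate it. -/
theorem forall_distribution_iff {t : ℝ} {Y : Module.End ℂ Q.dom} :
    (∀ T ∈ Q.distribution t, ⁅T, Y⁆ = 0) ↔ ∀ n, ∀ X ∈ Q.calC (n + 1), Commute (X t) Y := by
  constructor
  · exact fun h n X hX => sub_eq_zero.1 (h _ (Submodule.subset_span ⟨n, X, hX, rfl⟩))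
  · intro h T hT
    refine sub_eq_zero.2 (?_ : Commute T Y)
    induction hT using Submodule.span_induction with
    | mem T hT =>
      obtain ⟨n, X, hX, rfl⟩ := hT
      exact h n X hX
    | zero => exact Commute.zero_left _
    | add A B _ _ h h' => exact h.add_left h'
    | smul c A _ h => exact h.smul_left c

end ControlSystem

/-! ### Uniqueness of solutions and the Ehrenfest equation -/

theorem analyticOn_inner {K : Type*} [NormedAddCommGroup K] [InnerProductSpace ℂ K]
    {f g : ℝ → K} {s : Set ℝ} (hf : AnalyticOn ℝ f s) (hg : AnalyticOn ℝ g s) :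
    AnalyticOn ℝ (fun t => inner ℂ (f t) (g t)) s := by
  intro t ht
  have h : AnalyticAt ℝ (fun p : K × K => inner ℂ p.1 p.2) (f t, g t) :=
    ContinuousLinearMap.analyticAt_bilinear
      (isBoundedBilinearMap_inner (𝕜 := ℂ) (E := K)).toContinuousLinearMap (f t, g t)
  exact h.comp_analyticWithinAt_of_eq ((hf t ht).prod (hg t ht)) rfl

/-- A piecewise analytic control is analytic on a short interval to the right of each time. -/
theorem IsPiecewiseAnalytic.exists_isAnalyticPiece {r : ℕ} {t₀ t₁ a : ℝ} {u : ℝ → Fin r → ℝ}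
    (hu : IsPiecewiseAnalytic t₀ t₁ u) (ha : t₀ ≤ a) (ha' : a < t₁) :
    ∃ b, a < b ∧ b ≤ t₁ ∧ IsAnalyticPiece u a b := by
  obtain ⟨P, hP⟩ := hu
  have hev : ∀ᶠ b in nhdsWithin a (Set.Ioi a), ∀ p ∈ P, p ∉ Set.Ioo a b := by
    rw [Filter.eventually_all_finset]
    intro p _
    by_cases hp : a < p
    · filter_upwards [Ioo_mem_nhdsGT hp] with b hb hpb
      exact lt_asymm hb.2 hpb.2
    · exact Filter.Eventually.of_forall fun b hb => hp hb.1
  obtain ⟨b, hb, hb'⟩ := (hev.and (Ioo_mem_nhdsGT ha')).exists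
  exact ⟨b, hb'.1, hb'.2.le, hP a b ha hb'.1 hb'.2.le hb⟩

namespace ControlSystem

variable {S E : Type*} [NormedAddCommGroup S] [InnerProductSpace ℂ S]
  [NormedAddCommGroup E] [InnerProductSpace ℂ E] {r : ℕ} {Q : ControlSystem S E r}
  {𝒰 : Set (ℝ → Fin r → ℝ)} {W : OpFamily Q.dom} {u u' : ℝ → Fin r → ℝ} {s t : ℝ}
  {ξ ξ' : ℝ → Q.dom} {A : OpFamily Q.dom}

theorem skewHermitian_generator (hW : ∀ t, SkewHermitian (W t)) (u : ℝ → Fin r → ℝ) (t : ℝ) :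
    SkewHermitian (Q.generator W u t) :=
  (((Q.skew_H₀ t).add (Q.skew_He t)).add (hW t)).add
    (SkewHermitian.sum fun i _ => (Q.skew_Hc i t).real_smul (u t i))

theorem skewHermitian_interaction (hW : W = Q.HSB ∨ W = 0) (t : ℝ) : SkewHermitian (W t) := by
  rcases hW with rfl | rfl
  exacts [Q.skew_HSB t, SkewHermitian.zero]

/-- Solutions for controls that agree up to time `t` agree up to time `t`. -/
theorem IsSolution.eqOn (hW : ∀ t, SkewHermitian (W t)) (ht : t ≤ Q.t₁)
    (hξ : Q.IsSolution W u s ξ) (hξ' : Q.IsSolution W u' s ξ') (h : ξ s = ξ' s)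
    (hu : Set.EqOn u u' (Set.Ico s t)) : Set.EqOn ξ ξ' (Set.Icc s t) := by
  have hcont : ContinuousOn (fun τ => ((ξ τ - ξ' τ : Q.dom) : HilbertTensor S E))
      (Set.Icc s t) :=
    (hξ.1.sub hξ'.1).mono (Set.Icc_subset_Icc_right ht)
  have hderiv : ∀ τ ∈ Set.Ico s t, HasDerivWithinAt (fun τ =>
      inner ℂ ((ξ τ - ξ' τ : Q.dom) : HilbertTensor S E) ((ξ τ - ξ' τ : Q.dom) : HilbertTensor S E))
      0 (Set.Ici τ) τ := by
    intro τ hτ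
    have h1 := (hξ.2 τ ⟨hτ.1, hτ.2.trans_le ht⟩).sub (hξ'.2 τ ⟨hτ.1, hτ.2.trans_le ht⟩)
    have hgen : Q.generator W u' τ = Q.generator W u τ := by
      simp only [generator, hu hτ]
    rw [hgen, ← Submodule.coe_sub, ← map_sub] at h1
    -- The difference of two solutions solves the same linear equation, and a skew-Hermitian
    -- generator conserves its norm; no bound on the generator is needed.
    have h2 := h1.inner ℂ h1
    refine h2.congr_deriv ?_
    change inner ℂ ((ξ τ - ξ' τ : Q.dom) : HilbertTensor S E) _
      + inner ℂ _ ((ξ τ - ξ' τ : Q.dom) : HilbertTensor S E) = 0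
    rw [(skewHermitian_generator hW u τ).inner_apply]
    exact add_neg_cancel _
  have hconst := constant_of_has_deriv_right_zero (hcont.inner hcont) hderiv
  intro τ hτ
  have := hconst τ hτ
  rw [h, sub_self, Submodule.coe_zero, inner_zero_left, inner_self_eq_zero,
    Submodule.coe_eq_zero] at this
  exact sub_eq_zero.1 this

/-- The environment term disappears because members of `systemSpan` commute with `He`. -/
theorem ad_generator (hA : A ∈ Q.systemSpan) (W : OpFamily Q.dom) (u : ℝ → Fin r → ℝ) (t : ℝ) :
    ad (Q.generator W u) A t = ad Q.H₀ A t + ad W A t + ∑ i, (u t i : ℂ) • ad (Q.Hc i) A t := by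
  simp only [ad_apply, generator, mul_add, add_mul, Finset.mul_sum, Finset.sum_mul,
    mul_smul_comm, smul_mul_assoc, smul_sub, Finset.sum_sub_distrib, (hA.2 t t).eq]
  abel

section

variable (hd : ∀ A, Q.IsWord A → ∀ t ∈ Set.Icc Q.t₀ Q.t₁,
  ∃ B : Module.End ℂ Q.dom, HasOpDerivAt Q.t₀ Q.t₁ A B t)

include hd

/-- Where an operator family is differentiable along a solution, its derivative is given by the
product rule. -/
theorem IsSolution.hasDerivWithinAt_apply (hA : A ∈ Q.wordSpan) (hs : Q.t₀ ≤ s)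
    (hξ : Q.IsSolution W u s ξ) (ht : t ∈ Set.Ico s Q.t₁)
    (hdiff : DifferentiableWithinAt ℝ (fun τ => ((A τ (ξ τ) : Q.dom) : HilbertTensor S E))
      (Set.Ici t) t) :
    HasDerivWithinAt (fun τ => ((A τ (ξ τ) : Q.dom) : HilbertTensor S E))
      (((A t * Q.generator W u t + Q.deriv A t) (ξ t) : Q.dom) : HilbertTensor S E)
      (Set.Ici t) t := by
  obtain ⟨B, hB, hadj⟩ := exists_formalAdjoint hd hA
  have htI : t ∈ Set.Icc Q.t₀ Q.t₁ := ⟨hs.trans ht.1, ht.2.le⟩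
  have h1 := hdiff.hasDerivWithinAt
  -- Convergence of the difference quotients of `ξ` says nothing about their images under an
  -- unbounded `A τ`. The derivative, whose existence is assumed, is therefore identified weakly:
  -- with `A τ` moved to a fixed `η` as `B τ`, the ordinary product rule applies.
  refine h1.congr_deriv (Q.dense_dom.eq_of_inner_left ℂ fun η hη => ?_)
  lift η to Q.dom using hη
  have hBη : HasDerivWithinAt (fun τ => ((B τ η : Q.dom) : HilbertTensor S E))
      ((Q.deriv B t η : Q.dom) : HilbertTensor S E) (Set.Ici t) t :=
    ((hasOpDerivAt_of_mem_wordSpan hd hB htI η).mono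
      (Set.Icc_subset_Icc_left htI.1)).mono_of_mem_nhdsWithin (Icc_mem_nhdsGE ht.2)
  have h2 := h1.inner ℂ (hasDerivWithinAt_const t (Set.Ici t) (η : HilbertTensor S E))
  have h3 := (hξ.2 t ht).inner ℂ hBη
  simp only [fun τ => hadj τ (ξ τ) η] at h2
  have h4 := UniqueDiffWithinAt.eq_deriv _ (uniqueDiffOn_Ici t t Set.self_mem_Ici) h2 h3
  rw [inner_zero_right, zero_add] at h4
  rw [h4, LinearMap.add_apply, Module.End.mul_apply, Submodule.coe_add, inner_add_left,
    hadj t _ η, formalAdjoint_deriv hd hA hB hadj t _ η, add_comm]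

/-- With `G` the generator, skewness turns `⟨Gξ, Aξ⟩ + ⟨ξ, (AG + A')ξ⟩` into the expectation value
of `ad G A + A'`. -/
theorem IsSolution.hasDerivWithinAt_expVal (hW : ∀ t, SkewHermitian (W t))
    (hA : A ∈ Q.systemSpan) (hs : Q.t₀ ≤ s)
    (hξ : Q.IsSolution W u s ξ) (ht : t ∈ Set.Ico s Q.t₁)
    (hdiff : DifferentiableWithinAt ℝ (fun τ => ((A τ (ξ τ) : Q.dom) : HilbertTensor S E))
      (Set.Ici t) t) :
    HasDerivWithinAt (fun τ => expVal (A τ) (ξ τ))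
      (expVal (Q.driftStep A t) (ξ t) + ∑ i, (u t i : ℂ) * expVal (ad (Q.Hc i) A t) (ξ t)
        + expVal (ad W A t) (ξ t)) (Set.Ici t) t := by
  have h := (hξ.2 t ht).inner ℂ (hξ.hasDerivWithinAt_apply hd hA.1 hs ht hdiff)
  refine h.congr_deriv ?_
  have h5 : expVal (Q.driftStep A t) (ξ t) + ∑ i, (u t i : ℂ) * expVal (ad (Q.Hc i) A t) (ξ t)
      + expVal (ad W A t) (ξ t) = expVal (ad (Q.generator W u) A t + Q.deriv A t) (ξ t) := by
    rw [ad_generator hA, driftStep, Pi.add_apply]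
    simp only [expVal_add, expVal_sum, expVal_smul]
    ring
  rw [h5, (skewHermitian_generator hW u t).inner_apply, ad_apply, expVal, LinearMap.add_apply,
    LinearMap.add_apply, LinearMap.sub_apply, Submodule.coe_add, Submodule.coe_add,
    Submodule.coe_sub, inner_add_right, inner_add_right, inner_sub_right, Module.End.mul_apply,
    Module.End.mul_apply]
  ring

end

/-- Along each solution, combinations of words are analytic wherever the control is. -/
theorem IsAnalyticSystem.analyticOn (hanalytic : Q.IsAnalyticSystem 𝒰) (hW : W = Q.HSB ∨ W = 0)
    (hu : u ∈ 𝒰) (hs : s ∈ Set.Icc Q.t₀ Q.t₁) (hξ : Q.IsSolution W u s ξ) {a b : ℝ} (ha : s ≤ a)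
    (hab : a < b) (hb : b ≤ Q.t₁) (hp : IsAnalyticPiece u a b) (hA : A ∈ Q.wordSpan) :
    AnalyticOn ℝ (fun t => ((A t (ξ t) : Q.dom) : HilbertTensor S E)) (Set.Icc a b) := by
  induction hA using Submodule.span_induction with
  | mem A hA => exact hanalytic.2 W hW u hu s hs ξ hξ a b ha hab hb hp A hA
  | zero => exact analyticOn_const (v := (0 : HilbertTensor S E))
  | add A B _ _ h h' => exact h.add h'
  | smul c A _ h => exact AnalyticOn.smul (analyticOn_const (v := c)) h

theorem IsAnalyticSystem.analyticOn_expVal (hanalytic : Q.IsAnalyticSystem 𝒰)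
    (hW : W = Q.HSB ∨ W = 0) (hu : u ∈ 𝒰) (hs : s ∈ Set.Icc Q.t₀ Q.t₁)
    (hξ : Q.IsSolution W u s ξ) {a b : ℝ} (ha : s ≤ a) (hab : a < b) (hb : b ≤ Q.t₁)
    (hp : IsAnalyticPiece u a b) (hA : A ∈ Q.wordSpan) :
    AnalyticOn ℝ (fun t => expVal (A t) (ξ t)) (Set.Icc a b) :=
  analyticOn_inner
    (hanalytic.analyticOn hW hu hs hξ ha hab hb hp IsWord.one.mem_wordSpan)
    (hanalytic.analyticOn hW hu hs hξ ha hab hb hp hA)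

/-- The Ehrenfest equation for an observable that acts on the system. -/
theorem IsAnalyticSystem.hasDerivWithinAt_expVal (hanalytic : Q.IsAnalyticSystem 𝒰)
    (hW : W = Q.HSB ∨ W = 0) (hu : u ∈ 𝒰) (hu' : IsPiecewiseAnalytic Q.t₀ Q.t₁ u)
    (hs : s ∈ Set.Icc Q.t₀ Q.t₁) (hξ : Q.IsSolution W u s ξ) (ht : t ∈ Set.Ico s Q.t₁)
    (hA : A ∈ Q.systemSpan) :
    HasDerivWithinAt (fun τ => expVal (A τ) (ξ τ))
      (expVal (Q.driftStep A t) (ξ t) + ∑ i, (u t i : ℂ) * expVal (ad (Q.Hc i) A t) (ξ t)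
        + expVal (ad W A t) (ξ t)) (Set.Ici t) t := by
  obtain ⟨b, htb, hb, hp⟩ := hu'.exists_isAnalyticPiece (hs.1.trans ht.1) ht.2
  refine hξ.hasDerivWithinAt_expVal hanalytic.1 (skewHermitian_interaction hW) hA hs.1 ht ?_
  exact ((hanalytic.analyticOn hW hu hs hξ ht.1 htb hb hp hA.1).differentiableOn t
    ⟨le_rfl, htb.le⟩).mono_of_mem_nhdsWithin (Icc_mem_nhdsGE htb)

end ControlSystem

/-! ### Flat analytic functions, infinite linear systems, chaining of pieces -/

/-- A function that is analytic on `[a, b]` and vanishes at `a` to infinite order is zero. -/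
theorem eqOn_zero_of_flat {f : ℝ → ℂ} {a b : ℝ} (hab : a < b) (hf : AnalyticOn ℝ f (Set.Icc a b))
    (hflat : ∀ k : ℕ, ∃ c : ℝ, ∀ t ∈ Set.Icc a b, ‖f t‖ ≤ c * (t - a) ^ k) :
    ∀ t ∈ Set.Icc a b, f t = 0 := by
  have haI : a ∈ Set.Icc a b := ⟨le_rfl, hab.le⟩
  have hnhds : nhdsWithin a (Set.Ioi a) ≤ nhdsWithin a (Set.Icc a b) :=
    nhdsWithin_le_iff.2 (Icc_mem_nhdsGT hab)
  obtain ⟨g, hfg, hg⟩ := analyticWithinAt_iff_exists_analyticAt.1 (hf a haI)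
  rw [Set.insert_eq_of_mem haI] at hfg
  have hg0 : ∀ᶠ t in nhds a, g t = 0 := by
    by_contra hne
    -- Otherwise `g = (t - a)^n h` with `h a ≠ 0`, while the bound of order `n + 1` forces `h a =
    -- 0`.
    obtain ⟨n, h, hh, hh0, hgh⟩ := hg.exists_eventuallyEq_pow_smul_nonzero_iff.2 hne
    obtain ⟨c, hc⟩ := hflat (n + 1)
    have hle : ∀ᶠ t in nhdsWithin a (Set.Ioi a), ‖h t‖ ≤ c * (t - a) := by
      filter_upwards [hnhds hfg, hgh.filter_mono nhdsWithin_le_nhds, Icc_mem_nhdsGT hab,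
        self_mem_nhdsWithin] with t h1 h2 h3 h4
      have hpos : 0 < t - a := sub_pos.2 h4
      have h5 := hc t h3
      rw [h1, h2, norm_smul, norm_pow, Real.norm_of_nonneg hpos.le, pow_succ', ← mul_assoc,
        mul_comm] at h5
      exact le_of_mul_le_mul_right h5 (pow_pos hpos n)
    have hlim : Filter.Tendsto (fun t => c * (t - a)) (nhdsWithin a (Set.Ioi a)) (nhds 0) := by
      have : ContinuousAt (fun t : ℝ => c * (t - a)) a := by fun_prop
      simpa using this.tendsto.mono_left (nhdsWithin_le_nhds (s := Set.Ioi a))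
    have := le_of_tendsto_of_tendsto
      (hh.continuousAt.norm.tendsto.mono_left nhdsWithin_le_nhds) hlim hle
    exact hh0 (norm_le_zero_iff.1 this)
  have hf0 : ∀ᶠ t in nhdsWithin a (Set.Ioi a), f t = 0 := by
    filter_upwards [hnhds hfg, hg0.filter_mono nhdsWithin_le_nhds] with t h1 h2
    rw [h1, h2]
  obtain ⟨c, hac, hc⟩ := mem_nhdsGT_iff_exists_Ioo_subset.1 hf0
  have hac' : a < min b c := lt_min hab hac
  obtain ⟨z, haz, hz⟩ := exists_between hac'
  have hfn : AnalyticOnNhd ℝ f (Set.Ioo a b) :=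
    (isOpen_Ioo.analyticOn_iff_analyticOnNhd).1 (hf.mono Set.Ioo_subset_Icc_self)
  have hzero : Set.EqOn f 0 (Set.Ioo a b) :=
    hfn.eqOn_zero_of_preconnected_of_eventuallyEq_zero isPreconnected_Ioo
      ⟨haz, hz.trans_le (min_le_left _ _)⟩
      (Filter.mem_of_superset (Ioo_mem_nhds haz (hz.trans_le (min_le_right _ _))) hc)
  have := hzero.of_subset_closure hf.continuousOn continuousOn_const Set.Ioo_subset_Icc_self
    (closure_Ioo hab.ne).ge
  exact this

/-- A family of functions that solves an infinite linear system of differential equations with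
zero initial values vanishes to infinite order at the initial time. -/
theorem flat_of_linear_system {ι : Type*} {r : ℕ} {f : ι → ℝ → ℂ} {d : ι → ι}
    {e : Fin r → ι → ι} {u : ℝ → Fin r → ℝ} {a b : ℝ}
    (hf : ∀ i, ContinuousOn (f i) (Set.Icc a b))
    (hderiv : ∀ i, ∀ t ∈ Set.Ico a b,
      HasDerivWithinAt (f i) (f (d i) t + ∑ j, (u t j : ℂ) * f (e j i) t) (Set.Ici t) t)
    (h0 : ∀ i, f i a = 0) {M : ℝ} (hM : ∀ t ∈ Set.Ico a b, ∀ j, |u t j| ≤ M) (k : ℕ) :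
    ∀ i, ∃ c : ℝ, ∀ t ∈ Set.Icc a b, ‖f i t‖ ≤ c * (t - a) ^ k := by
  induction k with
  | zero =>
    intro i
    obtain ⟨c, hc⟩ := isCompact_Icc.exists_bound_of_continuousOn (hf i)
    exact ⟨c, by simpa using hc⟩
  | succ k ih =>
    choose c hc using ih
    intro i
    -- The right derivative of `f i` is at most `c' (t - a)^k`; integrating gives the factor `1 / (k
    -- + 1)`. The constants need not be uniform in `i` or `k`.
    set c' : ℝ := c (d i) + ∑ j, M * c (e j i) with hc'
    refine ⟨c' / (k + 1), fun t ht => ?_⟩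
    refine image_norm_le_of_norm_deriv_right_le_deriv_boundary (hf i) (hderiv i)
      (B := fun t => c' / (k + 1) * (t - a) ^ (k + 1)) (B' := fun t => c' * (t - a) ^ k)
      (by simp [h0]) (fun x => ?_) (fun x hx => ?_) ht
    · have h1 := (((hasDerivAt_id x).sub_const a).pow (k + 1)).const_mul (c' / (k + 1))
      refine h1.congr_deriv ?_
      have : (k : ℝ) + 1 ≠ 0 := by positivity
      simp only [id, Nat.add_sub_cancel, Nat.cast_add, Nat.cast_one, mul_one]
      field_simp
    · have hxI := Set.Ico_subset_Icc_self hx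
      rw [hc', add_mul, Finset.sum_mul]
      refine (norm_add_le _ _).trans (add_le_add (hc _ x hxI) ((norm_sum_le _ _).trans
        (Finset.sum_le_sum fun j _ => ?_)))
      rw [norm_mul, Complex.norm_real, Real.norm_eq_abs, mul_assoc]
      exact mul_le_mul (hM x hx j) (hc _ x hxI) (norm_nonneg _)
        ((abs_nonneg _).trans (hM x hx j))

/-- A transitive relation between times that holds across all intervals without breakpoints holds
between all times. -/
theorem rel_of_pieces {R : ℝ → ℝ → Prop} {s e : ℝ} {P : Finset ℝ}
    (htrans : ∀ a b c, R a b → R b c → R a c)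
    (hR : ∀ a b, s ≤ a → a < b → b ≤ e → (∀ p ∈ P, p ∉ Set.Ioo a b) → R a b) (a b : ℝ)
    (ha : s ≤ a) (hab : a < b) (hb : b ≤ e) : R a b := by
  classical
  -- Splitting at an interior breakpoint leaves strictly fewer of them inside each half.
  induction hn : (P.filter (· ∈ Set.Ioo a b)).card using Nat.strong_induction_on
    generalizing a b with
  | _ n ih =>
  by_cases h : ∀ p ∈ P, p ∉ Set.Ioo a b
  · exact hR a b ha hab hb h
  push Not at h
  obtain ⟨p, hp, hpI⟩ := h
  have hmem : p ∈ P.filter (· ∈ Set.Ioo a b) := Finset.mem_filter.2 ⟨hp, hpI⟩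
  refine htrans a p b
    (ih _ ?_ a p ha hpI.1 (hpI.2.le.trans hb) rfl) (ih _ ?_ p b (ha.trans hpI.1.le) hpI.2 hb rfl)
  all_goals
    rw [← hn]
    refine Finset.card_lt_card ((Finset.ssubset_iff_of_subset fun q hq => ?_).2 ⟨p, hmem, ?_⟩)
  · rw [Finset.mem_filter] at hq ⊢
    exact ⟨hq.1, hq.2.1, hq.2.2.trans hpI.2⟩
  · simp
  · rw [Finset.mem_filter] at hq ⊢
    exact ⟨hq.1, hpI.1.trans hq.2.1, hq.2.2⟩
  · simp

theorem IsAnalyticPiece.exists_bound {r : ℕ} {u : ℝ → Fin r → ℝ} {a b : ℝ}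
    (h : IsAnalyticPiece u a b) : ∃ M, ∀ t ∈ Set.Ico a b, ∀ j, |u t j| ≤ M := by
  obtain ⟨g, hg, hug⟩ := h
  obtain ⟨M, hM⟩ := isCompact_Icc.exists_bound_of_continuousOn hg.continuousOn
  refine ⟨M, fun t ht j => ?_⟩
  rw [hug ht, ← Real.norm_eq_abs]
  exact (norm_le_pi_norm _ j).trans (hM t (Set.Ico_subset_Icc_self ht))

/-! ### Commutation implies decoupling -/

namespace ControlSystem

variable {S E : Type*} [NormedAddCommGroup S] [InnerProductSpace ℂ S]
  [NormedAddCommGroup E] [InnerProductSpace ℂ E] {r : ℕ} {Q : ControlSystem S E r}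
  {𝒰 : Set (ℝ → Fin r → ℝ)}

theorem calC_subset_systemSpan (hanalytic : Q.IsAnalyticSystem 𝒰) (n : ℕ) :
    Q.calC n ⊆ Q.systemSpan :=
  calC_subset C_mem_systemSpan (fun i _ hX => ad_Hc_mem_systemSpan hX i)
    (fun _ hX => driftStep_mem_systemSpan hanalytic.1 hX) n

theorem isDecoupled_of_commute (hr : 0 < r) (h𝒰 : IsAdmissibleClass Q.t₀ Q.t₁ 𝒰)
    (hanalytic : Q.IsAnalyticSystem 𝒰)
    (hcomm : ∀ t ∈ Set.Icc Q.t₀ Q.t₁, ∀ n, ∀ X ∈ Q.calC (n + 1), Commute (X t) (Q.HSB t)) :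
    Q.IsDecoupled 𝒰 := by
  intro u hu s hs ξ₀ _ ξ η hξ hξs hη hηs t ht
  -- This index set is closed under both operations of the system: `driftStep` preserves `calC (n +
  -- 1)`, and brackets with controls raise `n` by one.
  let ι := {X : OpFamily Q.dom // ∃ n, X ∈ Q.calC (n + 1)}
  let f : ι → ℝ → ℂ := fun X τ => expVal (X.1 τ) (ξ τ) - expVal (X.1 τ) (η τ)
  let d : ι → ι := fun X => ⟨Q.driftStep X.1, X.2.imp fun _ h => driftStep_mem_calC h⟩
  let e : Fin r → ι → ι := fun j X =>
    ⟨ad (Q.Hc j) X.1, by obtain ⟨n, h⟩ := X.2; exact ⟨n + 1, ad_mem_calC h j⟩⟩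
  have hsys : ∀ X : ι, X.1 ∈ Q.systemSpan := fun X =>
    X.2.elim fun n h => calC_subset_systemSpan hanalytic (n + 1) h
  have hu' := h𝒰.1 u hu
  have hderiv : ∀ X, ∀ τ ∈ Set.Ico s Q.t₁, HasDerivWithinAt (f X)
      (f (d X) τ + ∑ j, (u τ j : ℂ) * f (e j X) τ) (Set.Ici τ) τ := by
    intro X τ hτ
    have h1 := hanalytic.hasDerivWithinAt_expVal (.inl rfl) hu hu' hs hξ hτ (hsys X)
    have h2 := hanalytic.hasDerivWithinAt_expVal (.inr rfl) hu hu' hs hη hτ (hsys X)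
    have h3 : ad Q.HSB X.1 τ = 0 :=
      sub_eq_zero.2 (X.2.elim fun n h => hcomm τ ⟨hs.1.trans hτ.1, hτ.2.le⟩ n X.1 h)
    have h4 : ad 0 X.1 τ = 0 := by simp [ad_apply]
    rw [h3, expVal_zero, add_zero] at h1
    rw [h4, expVal_zero, add_zero] at h2
    refine (h1.sub h2).congr_deriv ?_
    simp only [f, d, e, mul_sub, Finset.sum_sub_distrib]
    ring
  suffices h : ∀ X, f X t = 0 from
    sub_eq_zero.1 (h ⟨Q.C, 0, C_mem_calC_one hr⟩)
  have hfs : ∀ X, f X s = 0 := fun X => by simp only [f, hξs, hηs, sub_self]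
  rcases ht.1.eq_or_lt with rfl | hst
  · exact hfs
  obtain ⟨P, hP⟩ := hu'
  -- The whole family must be propagated, not only the component of `C`: the next piece needs all
  -- initial values to vanish.
  refine rel_of_pieces (R := fun a b => (∀ X, f X a = 0) → ∀ X, f X b = 0) (s := s) (e := Q.t₁)
    (P := P) (fun a b c h h' h0 => h' (h h0)) (fun a b ha hab hb hab' h0 X => ?_) s t le_rfl hst
    ht.2 hfs
  have hp := hP a b (hs.1.trans ha) hab hb hab'
  have hf : ∀ X, AnalyticOn ℝ (f X) (Set.Icc a b) := fun X =>
    (hanalytic.analyticOn_expVal (.inl rfl) hu hs hξ ha hab hb hp (hsys X).1).sub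
      (hanalytic.analyticOn_expVal (.inr rfl) hu hs hη ha hab hb hp (hsys X).1)
  obtain ⟨M, hM⟩ := hp.exists_bound
  exact eqOn_zero_of_flat hab (hf X) (fun k => flat_of_linear_system (fun X => (hf X).continuousOn)
    (fun X τ hτ => hderiv X τ ⟨ha.trans hτ.1, hτ.2.trans_le hb⟩) h0 hM k X) b ⟨hab.le, le_rfl⟩

end ControlSystem

/-! ### Decoupling implies commutation -/

theorem IsPiecewiseConstant.const {r : ℕ} {U : Set (Fin r → ℝ)} {v : Fin r → ℝ} (hv : v ∈ U) :
    IsPiecewiseConstant U fun _ => v :=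
  ⟨fun _ => hv, ∅, fun _ _ _ _ => rfl⟩

/-- Switching a piecewise constant control to a constant value at time `t`. -/
theorem IsPiecewiseConstant.switch {r : ℕ} {U : Set (Fin r → ℝ)} {u : ℝ → Fin r → ℝ}
    (hu : IsPiecewiseConstant U u) {v : Fin r → ℝ} (hv : v ∈ U) (t : ℝ) :
    IsPiecewiseConstant U fun τ => if τ < t then u τ else v := by
  classical
  obtain ⟨hU, P, hP⟩ := hu
  refine ⟨fun τ => ?_, insert t P, fun a b hab h => ?_⟩
  · dsimp only
    split_ifs
    exacts [hU τ, hv]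
  · have ht : t ∉ Set.Ioc a b := h t (Finset.mem_insert_self _ _)
    have hu : u a = u b := hP a b hab fun p hp => h p (Finset.mem_insert_of_mem hp)
    by_cases hb : b < t
    · simp only [hb, hab.trans_lt hb, if_true, hu]
    · have ha : ¬a < t := fun ha => ht ⟨ha, not_lt.1 hb⟩
      simp only [ha, hb, if_false]

/-- An affine function that vanishes on a set with full affine span vanishes. -/
theorem affine_eq_zero {r : ℕ} {U : Set (Fin r → ℝ)} (hU : affineSpan ℝ U = ⊤) {a : ℂ}
    {b : Fin r → ℂ} (h : ∀ v ∈ U, a + ∑ i, (v i : ℂ) * b i = 0) : a = 0 ∧ ∀ i, b i = 0 := by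
  have key : ∀ v : Fin r → ℝ, a + ∑ i, (v i : ℂ) * b i = 0 := fun v => by
    have hv : v ∈ affineSpan ℝ U := hU ▸ AffineSubspace.mem_top ℝ _ v
    refine affineSpan_induction (p := fun v : Fin r → ℝ => a + ∑ i, (v i : ℂ) * b i = 0) hv h ?_
    intro c x y z hx hy hz
    have hexp : ∑ i, (((c • (x -ᵥ y) +ᵥ z) i : ℝ) : ℂ) * b i = c * (∑ i, (x i : ℂ) * b i)
        - c * (∑ i, (y i : ℂ) * b i) + ∑ i, (z i : ℂ) * b i := by
      rw [Finset.mul_sum, Finset.mul_sum, ← Finset.sum_sub_distrib, ← Finset.sum_add_distrib]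
      refine Finset.sum_congr rfl fun i _ => ?_
      simp only [vsub_eq_sub, vadd_eq_add, Pi.add_apply, Pi.smul_apply, Pi.sub_apply, smul_eq_mul]
      push_cast
      ring
    rw [hexp]
    linear_combination (c : ℂ) * hx - (c : ℂ) * hy + hz
  have ha : a = 0 := by simpa using key 0
  refine ⟨ha, fun i => ?_⟩
  have := key (Pi.single i 1)
  rw [ha, zero_add, Finset.sum_eq_single i (fun j _ hj => by simp [hj]) (by simp)] at this
  simpa using this

namespace ControlSystem

variable {S E : Type*} [NormedAddCommGroup S] [InnerProductSpace ℂ S]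
  [NormedAddCommGroup E] [InnerProductSpace ℂ E] {r : ℕ} {Q : ControlSystem S E r}
  {𝒰 : Set (ℝ → Fin r → ℝ)} {U : Set (Fin r → ℝ)} {X : OpFamily Q.dom}

variable (Q) in
/-- The families whose expectation values do not depend on the presence of the interaction, for all
piecewise constant controls with values in `U`. -/
def invariantSpan (U : Set (Fin r → ℝ)) : Submodule ℝ (OpFamily Q.dom) where
  carrier := {X | ∀ u, IsPiecewiseConstant U u → ∀ s ∈ Set.Icc Q.t₀ Q.t₁, ∀ ξ η : ℝ → Q.dom,
    Q.IsSolution Q.HSB u s ξ → Q.IsSolution 0 u s η → ξ s = η s →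
      ‖(ξ s : HilbertTensor S E)‖ = 1 → ∀ t ∈ Set.Ico s Q.t₁,
        expVal (X t) (ξ t) = expVal (X t) (η t)}
  add_mem' := fun {X Y} hX hY u hu s hs ξ η hξ hη h hn t ht => by
    rw [Pi.add_apply, expVal_add, expVal_add, hX u hu s hs ξ η hξ hη h hn t ht,
      hY u hu s hs ξ η hξ hη h hn t ht]
  zero_mem' := fun u hu s hs ξ η hξ hη h hn t ht => by
    rw [Pi.zero_apply, expVal_zero, expVal_zero]
  smul_mem' := fun c X hX u hu s hs ξ η hξ hη h hn t ht => by
    rw [Pi.smul_apply, expVal_real_smul, expVal_real_smul, hX u hu s hs ξ η hξ hη h hn t ht]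

section

variable (h𝒰 : ∀ u ∈ 𝒰, IsPiecewiseAnalytic Q.t₀ Q.t₁ u) (hanalytic : Q.IsAnalyticSystem 𝒰)
  (hU : ∀ u, IsPiecewiseConstant U u → u ∈ 𝒰)

include h𝒰 hanalytic hU

/-- The right derivatives of the two expectation values of an invariant family agree. -/
theorem deriv_expVal_eq (hX : X ∈ Q.systemSpan) (hX' : X ∈ Q.invariantSpan U)
    {u : ℝ → Fin r → ℝ} (hu : IsPiecewiseConstant U u) {s : ℝ} (hs : s ∈ Set.Icc Q.t₀ Q.t₁)
    {ξ η : ℝ → Q.dom} (hξ : Q.IsSolution Q.HSB u s ξ) (hη : Q.IsSolution 0 u s η)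
    (h : ξ s = η s) (hn : ‖(ξ s : HilbertTensor S E)‖ = 1) {t : ℝ} (ht : t ∈ Set.Ico s Q.t₁) :
    expVal (Q.driftStep X t) (ξ t) + ∑ i, (u t i : ℂ) * expVal (ad (Q.Hc i) X t) (ξ t)
        + expVal (ad Q.HSB X t) (ξ t) =
      expVal (Q.driftStep X t) (η t) + ∑ i, (u t i : ℂ) * expVal (ad (Q.Hc i) X t) (η t) := by
  have h1 := hanalytic.hasDerivWithinAt_expVal (.inl rfl) (hU u hu) (h𝒰 u (hU u hu)) hs hξ ht hX
  have h2 := hanalytic.hasDerivWithinAt_expVal (.inr rfl) (hU u hu) (h𝒰 u (hU u hu)) hs hη ht hX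
  have h3 : ad 0 X t = 0 := by simp [ad_apply]
  rw [h3, expVal_zero, add_zero] at h2
  refine UniqueDiffWithinAt.eq_deriv _ (uniqueDiffOn_Ici t t Set.self_mem_Ici) h1
    (h2.congr_of_eventuallyEq ?_ (hX' u hu s hs ξ η hξ hη h hn t ht))
  filter_upwards [Ico_mem_nhdsGE ht.2] with τ hτ
  exact hX' u hu s hs ξ η hξ hη h hn τ ⟨ht.1.trans hτ.1, hτ.2⟩

variable (hwell : Q.IsWellPosed 𝒰)

include hwell

/-- Two solutions started at time `t` in the same arbitrary unit vector have equal right derivatives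
of `⟨X⟩`; at `t` all terms cancel except that of the interaction. -/
theorem ad_HSB_eq_zero (hne : U.Nonempty) (hX : X ∈ Q.systemSpan) (hX' : X ∈ Q.invariantSpan U)
    {t : ℝ} (ht : t ∈ Set.Ico Q.t₀ Q.t₁) : ad Q.HSB X t = 0 := by
  refine eq_zero_of_expVal_eq_zero fun ξ₀ hξ₀ => ?_
  obtain ⟨v, hv⟩ := hne
  have hpc := IsPiecewiseConstant.const hv
  have htI := Set.Ico_subset_Icc_self ht
  obtain ⟨ξ, hξ, hξt⟩ := hwell Q.HSB (.inl rfl) _ (hU _ hpc) t htI ξ₀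
  obtain ⟨η, hη, hηt⟩ := hwell 0 (.inr rfl) _ (hU _ hpc) t htI ξ₀
  have := deriv_expVal_eq h𝒰 hanalytic hU hX hX' hpc htI hξ hη (hξt.trans hηt.symm)
    (hξt ▸ hξ₀) ⟨le_rfl, ht.2⟩
  rw [hξt, hηt] at this
  exact add_eq_left.1 this

/-- With the interaction term gone, the equality of derivatives is affine in the control value at
`t`. Letting that value vary over `U` without altering the past separates the drift term from each
control term. -/
theorem driftStep_ad_mem_invariantSpan (hspan : affineSpan ℝ U = ⊤) (hX : X ∈ Q.systemSpan)
    (hX' : X ∈ Q.invariantSpan U) :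
    Q.driftStep X ∈ Q.invariantSpan U ∧ ∀ i, ad (Q.Hc i) X ∈ Q.invariantSpan U := by
  have hne : U.Nonempty := (affineSpan_nonempty (k := ℝ)).1
    (hspan ▸ ⟨0, AffineSubspace.mem_top ℝ _ 0⟩)
  suffices key : ∀ u, IsPiecewiseConstant U u → ∀ s ∈ Set.Icc Q.t₀ Q.t₁, ∀ ξ η : ℝ → Q.dom,
      Q.IsSolution Q.HSB u s ξ → Q.IsSolution 0 u s η → ξ s = η s →
      ‖(ξ s : HilbertTensor S E)‖ = 1 → ∀ t ∈ Set.Ico s Q.t₁,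
      expVal (Q.driftStep X t) (ξ t) - expVal (Q.driftStep X t) (η t) = 0 ∧ ∀ i,
        expVal (ad (Q.Hc i) X t) (ξ t) - expVal (ad (Q.Hc i) X t) (η t) = 0 from
    ⟨fun u hu s hs ξ η hξ hη h hn t ht =>
      sub_eq_zero.1 (key u hu s hs ξ η hξ hη h hn t ht).1,
      fun i u hu s hs ξ η hξ hη h hn t ht =>
      sub_eq_zero.1 ((key u hu s hs ξ η hξ hη h hn t ht).2 i)⟩
  intro u hu s hs ξ η hξ hη h hn t ht
  refine affine_eq_zero hspan fun v hv => ?_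
  have hu' := hu.switch hv t
  set u' : ℝ → Fin r → ℝ := fun τ => if τ < t then u τ else v
  obtain ⟨ξ', hξ', hξs⟩ := hwell Q.HSB (.inl rfl) u' (hU u' hu') s hs (ξ s)
  obtain ⟨η', hη', hηs⟩ := hwell 0 (.inr rfl) u' (hU u' hu') s hs (ξ s)
  have huu' : Set.EqOn u' u (Set.Ico s t) := fun τ hτ => if_pos hτ.2
  have htI : t ∈ Set.Icc s t := ⟨ht.1, le_rfl⟩
  -- By uniqueness, switching at `t` leaves both states at `t` unchanged.
  have h1 : ξ' t = ξ t :=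
    hξ'.eqOn (skewHermitian_interaction (.inl rfl)) ht.2.le hξ hξs huu' htI
  have h2 : η' t = η t :=
    hη'.eqOn (skewHermitian_interaction (.inr rfl)) ht.2.le hη (hηs.trans h) huu' htI
  have h3 := deriv_expVal_eq h𝒰 hanalytic hU hX hX' hu' hs hξ' hη' (hξs.trans hηs.symm)
    (hξs ▸ hn) ht
  have h4 : u' t = v := if_neg (lt_irrefl t)
  rw [ad_HSB_eq_zero h𝒰 hanalytic hU hwell hne hX hX' ⟨hs.1.trans ht.1, ht.2⟩, expVal_zero,
    add_zero, h1, h2, h4] at h3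
  simp only [mul_sub, Finset.sum_sub_distrib]
  linear_combination h3

end

theorem C_mem_invariantSpan (hU : ∀ u, IsPiecewiseConstant U u → u ∈ 𝒰) (h : Q.IsDecoupled 𝒰) :
    Q.C ∈ Q.invariantSpan U :=
  fun u hu s hs ξ η hξ hη hs' hn t ht =>
    h u (hU u hu) s hs (ξ s) hn ξ η hξ rfl hη hs'.symm t (Set.Ico_subset_Icc_self ht)

theorem commute_of_isDecoupled (h𝒰 : IsAdmissibleClass Q.t₀ Q.t₁ 𝒰) (hwell : Q.IsWellPosed 𝒰)
    (hanalytic : Q.IsAnalyticSystem 𝒰) (h : Q.IsDecoupled 𝒰) {t : ℝ}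
    (ht : t ∈ Set.Icc Q.t₀ Q.t₁) (n : ℕ) (X : OpFamily Q.dom) (hX : X ∈ Q.calC n) :
    Commute (X t) (Q.HSB t) := by
  obtain ⟨h𝒰, U, hspan, hU⟩ := h𝒰
  have hne : U.Nonempty := (affineSpan_nonempty (k := ℝ)).1
    (hspan ▸ ⟨0, AffineSubspace.mem_top ℝ _ 0⟩)
  have hmem : X ∈ Q.systemSpan ⊓ Q.invariantSpan U :=
    calC_subset (M := Q.systemSpan ⊓ Q.invariantSpan U)
      ⟨C_mem_systemSpan, C_mem_invariantSpan hU h⟩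
      (fun i Y hY => ⟨ad_Hc_mem_systemSpan hY.1 i,
        (driftStep_ad_mem_invariantSpan h𝒰 hanalytic hU hwell hspan hY.1 hY.2).2 i⟩)
      (fun Y hY => ⟨driftStep_mem_systemSpan hanalytic.1 hY.1,
        (driftStep_ad_mem_invariantSpan h𝒰 hanalytic hU hwell hspan hY.1 hY.2).1⟩) n hX
  refine sub_eq_zero.1 (?_ : ad Q.HSB X t = 0)
  refine LinearMap.ext fun ξ => Subtype.ext ?_
  -- No right derivative is available at `t₁`, so the final time is reached by strong continuity of
  -- the bracket.
  have hcont : ContinuousOn (fun τ => ((ad Q.HSB X τ ξ : Q.dom) : HilbertTensor S E))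
      (Set.Icc Q.t₀ Q.t₁) := fun τ hτ =>
    (hasOpDerivAt_of_mem_wordSpan hanalytic.1
      (ad_mem_wordSpan IsWord.interaction.mem_wordSpan hmem.1.1) hτ ξ).continuousWithinAt
  have hzero : Set.EqOn (fun τ => ((ad Q.HSB X τ ξ : Q.dom) : HilbertTensor S E)) 0
      (Set.Ico Q.t₀ Q.t₁) := fun τ hτ => by
    dsimp only
    rw [ad_HSB_eq_zero h𝒰 hanalytic hU hwell hne hmem.1 hmem.2 hτ]
    rfl
  exact hzero.of_subset_closure hcont continuousOn_const Set.Ico_subset_Icc_self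
    (closure_Ico Q.lt.ne).ge ht

end ControlSystem

end OpenQuantum

end

theorem mainTheorem1 {S E : Type*} [NormedAddCommGroup S] [InnerProductSpace ℂ S] [CompleteSpace S]
    [NormedAddCommGroup E] [InnerProductSpace ℂ E] [CompleteSpace E] {r : ℕ} (hr : 0 < r)
    (Q : OpenQuantum.ControlSystem S E r) (𝒰 : Set (ℝ → Fin r → ℝ))
    (h𝒰 : OpenQuantum.IsAdmissibleClass Q.t₀ Q.t₁ 𝒰)
    (hwell : Q.IsWellPosed 𝒰) (hanalytic : Q.IsAnalyticSystem 𝒰) :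
    Q.IsDecoupled 𝒰 ↔
      ∀ t ∈ Set.Icc Q.t₀ Q.t₁, ∀ T ∈ Q.distribution t, ⁅T, Q.HSB t⁆ = 0 := by
  simp only [OpenQuantum.ControlSystem.forall_distribution_iff]
  exact ⟨fun h t ht n X hX => OpenQuantum.ControlSystem.commute_of_isDecoupled h𝒰 hwell hanalytic h
      ht (n + 1) X hX,
    fun h => OpenQuantum.ControlSystem.isDecoupled_of_commute hr h𝒰 hanalytic h⟩
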